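/- **Setting.** A worker with a KV cache of $M$ tokens must serve $n\ge 1$ requests, all present at time $0$. Every request has prompt size $s\ge 1$, and request $i$ has an output length $o_i\in\{\ell,\dots,u\}$, where $1\le \ell\le u$ are known integers; put $\alpha=\ell/u$. Time is discrete and schedules are non-preemptive: a request started at time $p$ occupies $s+a$ tokens of memory at time $p+a$ for $1\le a\le o_i$, and it is completed, and releases its memory, at time $p+o_i$. At every time the total occupied memory must be at most $M$. If request $i$ is started at time $p_i$, the total end-to-end latency is $\mathrm{TEL}=\sum_{i}(p_i+o_i)$. **Algorithms.** Both algorithms proceed greedily along a queue: at each time $t=0,1,2,\dots$, waiting requests are started one after another in queue order until no further one can be added without violating the memory constraint at some later time $t'>t$, where the memory used at $t'$ by the uncompleted requests already in process and by the newly started ones is projected from the output lengths that the algorithm assumes. * The hindsight shortest-first benchmark $\texttt{H-SF}$ knows the true lengths $o_i$, uses them in the projection, and queues the requests by increasing $o_i$ (so that at each time it starts a feasible set of largest cardinality, consisting of the shortest waiting requests). * The conservative algorithm $\mathcal A_{\max}$ assumes that every request has output length $u$, and queues the requests in a uniformly random order. The actual completion of a request is observed and releases its memory. The competitive ratio of $\mathcal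 A_{\max}$ with memory $M$ is $$\mathrm{CR}_M(\mathcal A_{\max})=\sup_{n\ge 1}\ \sup_{\mathbf o\in\{\ell,\dots,u\}^n}\frac{\mathbb E[\mathrm{TEL}(\mathbf o;\mathcal A_{\max})]}{\mathrm{TEL}(\mathbf o;\texttt{H-SF})}.$$ **Theorem.** For all fixed integers $s\ge 1$ and $1\le\ell\le u$, as $M\to\infty$, $$\mathrm{CR}_M(\mathcal A_{\max})\le \frac{\alpha^{-1}(1+\alpha^{-1})}{2}+O\!\left(\frac1M\right),$$ that is, there is a constant $C$, depending only on $s,\ell,u$, such that for all sufficiently large $M$ the ratio is at most $\frac{\alpha^{-1}(1+\alpha^{-1})}{2}+\frac CM$, uniformly in $n$ and $\mathbf o$. -/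

import Mathlib

open Filter
open scoped ENNReal

namespace LLMScheduling

/-! One worker with a cache of `M` tokens serves `n` requests of common prompt size `s`, all of them
present at time `0`. Request `i` has true output length `o i`. A request started at time `p` holds
`s + a` tokens at time `p + a`, for `1 ≤ a ≤ o i`, and is completed at time `p + o i`. -/

/-- Start times of the requests begun so far (`none`: still waiting). -/
abbrev State (n : ℕ) := Fin n → Option ℕ

/-- Memory held at time `t'` by a request of output length `len` that is started at time `p`. -/
def memory (s len p t' : ℕ) : ℕ :=
  if p < t' ∧ t' ≤ p + len then s + (t' - p) else 0

/-- Memory that the requests in process at time `t` (begun, and not truly completed by time `t`)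
will hold at the time `t'`, when their output lengths are taken to be `len`. -/
def activeMemory {n : ℕ} (s : ℕ) (o len : Fin n → ℕ) (start : State n) (t t' : ℕ) : ℕ :=
  ∑ i, match start i with
    | none => 0
    | some p => if t < p + o i then memory s (len i) p t' else 0

/-- The memory constraint, for all later times `t'`, when the set `U` of waiting requests is started
at time `t` and all output lengths are taken to be `len`. -/
def Feasible {n : ℕ} (M s : ℕ) (o len : Fin n → ℕ) (start : State n) (t : ℕ)
    (U : Finset (Fin n)) : Prop :=
  ∀ t' : ℕ, t < t' →
    activeMemory s o len start t t' + ∑ i ∈ U, memory s (len i) t t' ≤ M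

/-- The waiting requests, in queue order. -/
def waiting {n : ℕ} (queue : List (Fin n)) (start : State n) : List (Fin n) :=
  queue.filter fun i => (start i).isNone

open Classical in
/-- The number of requests started at time `t`: requests are added successively in queue order
until no further one can be added without violating the memory constraint at a later time. -/
noncomputable def batchSize {n : ℕ} (M s : ℕ) (o len : Fin n → ℕ) (queue : List (Fin n))
    (start : State n) (t : ℕ) : ℕ :=
  Nat.findGreatest (fun k => Feasible M s o len start t ((waiting queue start).take k).toFinset)
    (waiting queue start).length

/-- The set `I_t` of requests started at time `t`. -/
noncomputable def batch {n : ℕ} (M s : ℕ) (o len : Fin n → ℕ) (queue : List (Fin n))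
    (start : State n) (t : ℕ) : Finset (Fin n) :=
  ((waiting queue start).take (batchSize M s o len queue start t)).toFinset

/-- The state after the decisions at the times `0, …, t - 1`. The scheduler works with the lengths
`len`; the true lengths `o` enter only because completed requests release their memory. -/
noncomputable def run {n : ℕ} (M s : ℕ) (o len : Fin n → ℕ) (queue : List (Fin n)) : ℕ → State n
  | 0 => fun _ => none
  | t + 1 => fun i =>
      if i ∈ batch M s o len queue (run M s o len queue t) t then some t
      else run M s o len queue t i

/-- The start time of request `i` (`⊤` if it is never started). -/
noncomputable def startTime {n : ℕ} (M s : ℕ) (o len : Fin n → ℕ) (queue : List (Fin n))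
    (i : Fin n) : ℕ∞ :=
  ⨅ (t : ℕ) (_ : i ∈ batch M s o len queue (run M s o len queue t) t), (t : ℕ∞)

/-- Total end-to-end latency: the sum of the completion times `t + o i`, `i ∈ I_t`. -/
noncomputable def totalLatency {n : ℕ} (M s : ℕ) (o len : Fin n → ℕ) (queue : List (Fin n)) :
    ℝ≥0∞ :=
  ∑ i, ((startTime M s o len queue i : ℝ≥0∞) + (o i : ℝ≥0∞))

theorem memory_mono (s p t' : ℕ) {a b : ℕ} (h : a ≤ b) : memory s a p t' ≤ memory s b p t' := by
  unfold memory
  split_ifs <;> omega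

/-- The set started by `H-SF` has the largest cardinality among all feasible sets of waiting
requests. -/
theorem card_le_card_batch_hsf {n : ℕ} (M s : ℕ) (o : Fin n → ℕ) (start : State n) (t : ℕ)
    (U : Finset (Fin n)) (hU : ∀ i ∈ U, start i = none) (hf : Feasible M s o o start t U) :
    U.card ≤ (batch M s o o (List.ofFn (Tuple.sort o)) start t).card := by
  classical
  set W := waiting (List.ofFn (Tuple.sort o)) start with hW
  have hnd : W.Nodup := (List.nodup_ofFn.2 (Tuple.sort o).injective).filter _
  have hsort : W.Pairwise (fun i j => o i ≤ o j) := by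
    refine List.Pairwise.filter _ ?_
    rw [List.pairwise_ofFn]
    exact fun i j hij => Tuple.monotone_sort o hij.le
  have hUW : U ⊆ W.toFinset := by
    intro i hi
    simp only [hW, waiting, List.mem_toFinset, List.mem_filter, List.mem_ofFn, hU i hi]
    exact ⟨⟨(Tuple.sort o).symm i, by simp⟩, rfl⟩
  have hlen : U.card ≤ W.length := by
    rw [← List.toFinset_card_of_nodup hnd]
    exact Finset.card_le_card hUW
  have hcard : ∀ k ≤ W.length, (W.take k).toFinset.card = k := by
    intro k hk
    rw [List.toFinset_card_of_nodup (hnd.sublist (List.take_sublist _ _)), List.length_take]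
    omega
  have hsorted : ∀ a ∈ (W.take U.card).toFinset, ∀ b ∈ U \ (W.take U.card).toFinset, o a ≤ o b := by
    intro a ha b hb
    rw [Finset.mem_sdiff, List.mem_toFinset] at hb
    have hbW : b ∈ W := List.mem_toFinset.1 (hUW hb.1)
    rw [← List.take_append_drop U.card W] at hbW hsort
    rcases List.mem_append.1 hbW with h | h
    · exact absurd h hb.2
    · exact (List.pairwise_append.1 hsort).2.2 a (List.mem_toFinset.1 ha) b h
  have hfeas : Feasible M s o o start t (W.take U.card).toFinset := by
    intro t' ht'
    refine le_trans (Nat.add_le_add_left ?_ _) (hf t' ht')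
    set A := (W.take U.card).toFinset with hA
    have hAc : A.card = U.card := hcard _ hlen
    rw [← Finset.sum_sdiff_le_sum_sdiff]
    have hc : (A \ U).card = (U \ A).card := Finset.card_sdiff_comm hAc
    calc ∑ i ∈ A \ U, memory s (o i) t t'
        ≤ (A \ U).card • (A \ U).sup (fun i => memory s (o i) t t') :=
          Finset.sum_le_card_nsmul _ _ _ fun i hi =>
            Finset.le_sup (f := fun i => memory s (o i) t t') hi
      _ = (U \ A).card • (A \ U).sup (fun i => memory s (o i) t t') := by rw [hc]
      _ ≤ ∑ i ∈ U \ A, memory s (o i) t t' :=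
          Finset.card_nsmul_le_sum _ _ _ fun b hb => Finset.sup_le fun a ha =>
            memory_mono _ _ _ (hsorted a (Finset.mem_sdiff.1 ha).1 b hb)
  have hk : U.card ≤ batchSize M s o o (List.ofFn (Tuple.sort o)) start t :=
    Nat.le_findGreatest hlen hfeas
  have hb : batchSize M s o o (List.ofFn (Tuple.sort o)) start t ≤ W.length :=
    Nat.findGreatest_le _
  unfold batch
  rw [hcard _ hb]
  exact hk

/-- Hindsight shortest-first `H-SF`: the true lengths are known, and at each time the shortest
waiting requests are started, as many as the memory constraint allows. By exchange this is a
feasible set of largest cardinality (see `card_le_card_batch_hsf`). -/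
noncomputable def hsfLatency (M s : ℕ) {n : ℕ} (o : Fin n → ℕ) : ℝ≥0∞ :=
  totalLatency M s o o (List.ofFn (Tuple.sort o))

/-- Expected total latency of `𝒜_max`: every request is treated as having output length `u`,
and requests are queued in a uniformly random order. -/
noncomputable def amaxExpectedLatency (M s u : ℕ) {n : ℕ} (o : Fin n → ℕ) : ℝ≥0∞ :=
  (∑ σ : Equiv.Perm (Fin n), totalLatency M s o (fun _ => u) (List.ofFn σ)) /
    (n.factorial : ℝ≥0∞)

/-- The competitive ratio against `H-SF`, over all numbers `n ≥ 1` of requests and all output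
lengths in `[ℓ, u]`, of a policy with expected total latency `L o` on the instance `o`. -/
noncomputable def competitiveRatio (M s ℓ u : ℕ) (L : {n : ℕ} → (Fin n → ℕ) → ℝ≥0∞) : ℝ≥0∞ :=
  ⨆ (n : ℕ) (_ : 1 ≤ n) (o : Fin n → ℕ) (_ : ∀ i, ℓ ≤ o i ∧ o i ≤ u), L o / hsfLatency M s o

end LLMScheduling

/-!
Both algorithms start the requests along their queue, so a run amounts to a nondecreasing sequence
of start times (`exists_schedule`). Put `N = ⌊M / (s + u)⌋` and `K = ⌊M / (s + ℓ)⌋ + s + u`, and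
let `B_K(n) = ∑_{j < n} (⌊j / K⌋ + 1)` be the total latency of `n` unit requests served in batches
of `K`; with `batchWait`, this is `n + batchWait K n`.

*Upper bound for `𝒜_max`.* While a request waits, at least `N` requests are in process, since
otherwise one more would fit. Hence the first `m` start times sum to at most the sum of the first
`m - N` completion times, and iterating this gives `∑ p_j ≤ ∑ ⌊(n - 1 - j) / N⌋ o_j` along the queue
(`sum_start_le`). Averaged over the queues, the expected latency is at most `(∑ o_i / n) B_N(n)`.

*Lower bound for `H-SF`.* Time is divided into generations: a generation lasts for the output length
of the shortest request not yet started at its beginning. All requests of a generation are still in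
process at its end. Those started at least `ℓ` before the end hold `s + ℓ` tokens each by then, so
there are at most `M / (s + ℓ)` of them. The remaining ones, called late, are at most `s + u` in
number (`IsShortestFirst.card_late_le`): when the late period begins, the requests of earlier
generations are completed except for boundedly many late ones, because the lengths increase along
the queue; so the cache is already booked, up to `s + u` tokens, for a time that the late requests
have to share. Thus at most `K` requests are started per generation. With `y_v` the number of
requests of length at least `v`, summation over the generations yields
`TEL(H-SF) ≥ ℓ B_K(n) + ∑_{ℓ < v ≤ u} E(y_v)`, where `E(y) = y + batchWait K (y - K)`
(`IsShortestFirst.le_sum_start`).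

*Comparison.* One has `N B_N(n) ≤ K B_K(n)` (`mul_batchWait_mono`) and, for every level `v`,
`(y_v / n) B_K(n) ≤ B_K(n) / 2 + E(y_v)` (`two_mul_mul_batchWait_le`). Since
`∑ o_i = n ℓ + ∑_v y_v`, the ratio of the latencies is at most `(K / N) (1 + u / ℓ) / 2`, and
`K / N ≤ u / ℓ + O(1 / M)` because `ℓ (s + u) ≤ u (s + ℓ)`.
-/

namespace LLMScheduling

/-! ### Runs as sequences of start times -/

section Run

variable {n : ℕ} (M s : ℕ) (o len : Fin n → ℕ) (σ : Equiv.Perm (Fin n))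

/-- The number of requests begun at the times `0, …, t - 1` when the queue is
`σ 0, σ 1, …, σ (n - 1)`. -/
noncomputable def numStarted : ℕ → ℕ
  | 0 => 0
  | t + 1 => numStarted t +
      batchSize M s o len (List.ofFn σ) (run M s o len (List.ofFn σ) t) t

theorem waiting_eq_drop (start : State n) (c : ℕ)
    (h : ∀ j : Fin n, start (σ j) = none ↔ c ≤ (j : ℕ)) :
    waiting (List.ofFn σ) start = (List.ofFn σ).drop c := by
  unfold waiting
  conv_lhs => rw [← List.take_append_drop c (List.ofFn σ)]
  rw [List.filter_append, List.filter_eq_nil_iff.2, List.filter_eq_self.2, List.nil_append]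
  · intro i hi
    obtain ⟨k, hk, rfl⟩ := List.mem_drop_iff_getElem.1 hi
    rw [List.getElem_ofFn, (h _).2 (by simp)]
    rfl
  · intro i hi
    obtain ⟨k, hk, rfl⟩ := List.mem_take_iff_getElem.1 hi
    rw [List.getElem_ofFn]
    intro hn
    have := (h _).1 (Option.isNone_iff_eq_none.1 hn)
    simp at this hk
    omega

theorem mem_take_drop_ofFn (c k : ℕ) (j : Fin n) :
    σ j ∈ ((List.ofFn σ).drop c).take k ↔ c ≤ (j : ℕ) ∧ (j : ℕ) < c + k := by
  rw [List.mem_take_iff_getElem]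
  constructor
  · rintro ⟨i, hi, he⟩
    rw [List.getElem_drop, List.getElem_ofFn, σ.injective.eq_iff] at he
    simp at hi
    rw [← he]
    simp
    omega
  · rintro ⟨h1, h2⟩
    have := j.2
    refine ⟨j - c, ?_, ?_⟩
    · simp
      omega
    · rw [List.getElem_drop, List.getElem_ofFn, σ.injective.eq_iff]
      ext
      simp
      omega

/-- The requests begun before time `t` form a prefix of the queue. -/
theorem run_eq_none_iff (t : ℕ) (j : Fin n) :
    run M s o len (List.ofFn σ) t (σ j) = none ↔ numStarted M s o len σ t ≤ (j : ℕ) := by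
  induction t generalizing j with
  | zero => simp [run, numStarted]
  | succ t ih =>
    simp only [run, numStarted, batch, waiting_eq_drop σ _ _ ih, List.mem_toFinset,
      mem_take_drop_ofFn]
    split_ifs with h
    · simp
      omega
    · rw [ih]
      omega

theorem waiting_run (t : ℕ) :
    waiting (List.ofFn σ) (run M s o len (List.ofFn σ) t)
      = (List.ofFn σ).drop (numStarted M s o len σ t) :=
  waiting_eq_drop σ _ _ (run_eq_none_iff M s o len σ t)

theorem mem_batch_run_iff (t : ℕ) (j : Fin n) :
    σ j ∈ batch M s o len (List.ofFn σ) (run M s o len (List.ofFn σ) t) t ↔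
      numStarted M s o len σ t ≤ (j : ℕ) ∧ (j : ℕ) < numStarted M s o len σ (t + 1) := by
  rw [batch, waiting_run, List.mem_toFinset, mem_take_drop_ofFn, numStarted]

theorem numStarted_mono : Monotone (numStarted M s o len σ) :=
  monotone_nat_of_le_succ fun t => by rw [numStarted]; omega

theorem run_eq_some (t p : ℕ) (j : Fin n) (hp : p < t) (h1 : numStarted M s o len σ p ≤ (j : ℕ))
    (h2 : (j : ℕ) < numStarted M s o len σ (p + 1)) :
    run M s o len (List.ofFn σ) t (σ j) = some p := by
  induction t with
  | zero => omega
  | succ t ih =>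
    simp only [run]
    rcases Nat.lt_succ_iff_lt_or_eq.1 hp with h | rfl
    · rw [if_neg, ih h]
      rw [mem_batch_run_iff]
      have := numStarted_mono M s o len σ (show p + 1 ≤ t from h)
      omega
    · rw [if_pos ((mem_batch_run_iff M s o len σ p j).2 ⟨h1, h2⟩)]

/-- The requests started at time `t` join those in process, so that the memory projected at time `t`
is that of the requests begun by time `t`. -/
theorem activeMemory_run_succ (ho : ∀ i, 1 ≤ o i) (t x : ℕ) :
    activeMemory s o len (run M s o len (List.ofFn σ) (t + 1)) t x =
      activeMemory s o len (run M s o len (List.ofFn σ) t) t x +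
        ∑ i ∈ batch M s o len (List.ofFn σ) (run M s o len (List.ofFn σ) t) t,
          memory s (len i) t x := by
  unfold activeMemory
  rw [← Finset.sum_ite_mem_eq (batch M s o len (List.ofFn σ) _ t), ← Finset.sum_add_distrib]
  refine Finset.sum_congr rfl fun i _ => ?_
  obtain ⟨j, rfl⟩ := σ.surjective i
  simp only [run]
  split_ifs with h
  · have h0 := (run_eq_none_iff M s o len σ t j).2 ((mem_batch_run_iff M s o len σ t j).1 h).1
    have := ho (σ j)
    rw [h0]
    simp
    omega
  · simp

/-- The memory constraint is maintained; completions only release memory. -/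
theorem activeMemory_run_self_le (ho : ∀ i, 1 ≤ o i) (t x : ℕ) (hx : t < x) :
    activeMemory s o len (run M s o len (List.ofFn σ) (t + 1)) t x ≤ M := by
  classical
  have key : ∀ t, (∀ x, t < x → activeMemory s o len (run M s o len (List.ofFn σ) t) t x ≤ M) →
      ∀ x, t < x → activeMemory s o len (run M s o len (List.ofFn σ) (t + 1)) t x ≤ M := by
    intro t h x hx
    rw [activeMemory_run_succ M s o len σ ho]
    have h0 : Feasible M s o len (run M s o len (List.ofFn σ) t) t
        (((waiting (List.ofFn σ) (run M s o len (List.ofFn σ) t)).take 0).toFinset) := by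
      intro x hx
      simpa using h x hx
    exact Nat.findGreatest_spec (P := fun k => Feasible M s o len (run M s o len (List.ofFn σ) t) t
      ((waiting (List.ofFn σ) (run M s o len (List.ofFn σ) t)).take k).toFinset)
      (Nat.zero_le _) h0 x hx
  refine key t ?_ x hx
  clear hx
  induction t with
  | zero => intro x _; simp [activeMemory, run]
  | succ t ih =>
    intro x hx
    refine le_trans ?_ (key t ih x (by omega))
    unfold activeMemory
    refine Finset.sum_le_sum fun i _ => ?_
    cases run M s o len (List.ofFn σ) (t + 1) i with
    | none => simp
    | some p =>
      simp only
      split_ifs <;> omega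

/-- The batch of time `t` is maximal: the next request in the queue does not fit. -/
theorem exists_lt_activeMemory (ho : ∀ i, 1 ≤ o i) (t : ℕ) (j : Fin n)
    (hj : (j : ℕ) = numStarted M s o len σ (t + 1)) :
    ∃ x, t < x ∧ M < activeMemory s o len (run M s o len (List.ofFn σ) (t + 1)) t x +
      memory s (len (σ j)) t x := by
  classical
  by_contra! hcon
  set st := run M s o len (List.ofFn σ) t with hst
  have hlen : (waiting (List.ofFn σ) st).length = n - numStarted M s o len σ t := by
    rw [hst, waiting_run, List.length_drop, List.length_ofFn]
  have hj' : (j : ℕ) = numStarted M s o len σ t + batchSize M s o len (List.ofFn σ) st t := hj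
  have hjn := j.2
  have hnot := Nat.findGreatest_is_greatest (P := fun k => Feasible M s o len st t
      ((waiting (List.ofFn σ) st).take k).toFinset) (n := (waiting (List.ofFn σ) st).length)
      (k := batchSize M s o len (List.ofFn σ) st t + 1) (Nat.lt_succ_self _) (by omega)
  refine hnot fun x hx => ?_
  refine le_trans (le_of_eq ?_) (hcon x hx)
  rw [activeMemory_run_succ M s o len σ ho, add_assoc]
  refine congrArg _ ?_
  have hnm : σ j ∉ batch M s o len (List.ofFn σ) st t := by
    rw [mem_batch_run_iff]
    omega
  rw [add_comm (∑ i ∈ _, _)]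
  refine Eq.trans (Finset.sum_congr ?_ fun _ _ => rfl) (Finset.sum_insert hnm)
  ext i
  obtain ⟨i, rfl⟩ := σ.surjective i
  rw [Finset.mem_insert, mem_batch_run_iff, hst, waiting_run, List.mem_toFinset,
    mem_take_drop_ofFn, σ.injective.eq_iff, Fin.ext_iff, ← hst]
  omega

theorem exists_start (t : ℕ) (j : Fin n) (hj : (j : ℕ) < numStarted M s o len σ t) :
    ∃ p < t, numStarted M s o len σ p ≤ (j : ℕ) ∧ (j : ℕ) < numStarted M s o len σ (p + 1) := by
  induction t with
  | zero => simp [numStarted] at hj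
  | succ t ih =>
    by_cases h : (j : ℕ) < numStarted M s o len σ t
    · obtain ⟨p, hp, h'⟩ := ih h
      exact ⟨p, by omega, h'⟩
    · exact ⟨t, by omega, by omega, hj⟩

theorem memory_le (s len p x : ℕ) : memory s len p x ≤ s + len := by
  unfold memory
  split_ifs <;> omega

/-- While requests are waiting, some request is started within any `u + 1` consecutive times:
otherwise the cache would be empty at the last of them. -/
theorem numStarted_lt_numStarted_add {u : ℕ} (hM : s + u ≤ M) (ho : ∀ i, 1 ≤ o i ∧ o i ≤ u)
    (hlen : ∀ i, len i ≤ u) (t : ℕ) (h : numStarted M s o len σ (t + (u + 1)) < n) :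
    numStarted M s o len σ t < numStarted M s o len σ (t + (u + 1)) := by
  by_contra! hle
  have hmono := numStarted_mono M s o len σ
  obtain ⟨x, -, hx⟩ := exists_lt_activeMemory M s o len σ (fun i => (ho i).1) (t + u)
    ⟨numStarted M s o len σ (t + u + 1), h⟩ rfl
  refine absurd hx (not_lt.2 ?_)
  have h0 : activeMemory s o len (run M s o len (List.ofFn σ) (t + u + 1)) (t + u) x = 0 := by
    refine Finset.sum_eq_zero fun i _ => ?_
    obtain ⟨j, rfl⟩ := σ.surjective i
    by_cases hj : (j : ℕ) < numStarted M s o len σ t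
    · obtain ⟨p, hp, h1, h2⟩ := exists_start M s o len σ t j hj
      rw [run_eq_some M s o len σ _ p j (by omega) h1 h2]
      have := (ho (σ j)).2
      simp only
      rw [if_neg (by omega)]
    · rw [(run_eq_none_iff M s o len σ _ j).2 (by rw [← add_assoc] at hle; omega)]
  rw [h0, zero_add]
  exact (memory_le _ _ _ _).trans ((Nat.add_le_add_left (hlen _) s).trans hM)

theorem exists_lt_numStarted {u : ℕ} (hM : s + u ≤ M) (ho : ∀ i, 1 ≤ o i ∧ o i ≤ u)
    (hlen : ∀ i, len i ≤ u) (j : Fin n) : ∃ t, (j : ℕ) < numStarted M s o len σ t := by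
  by_contra! hcon
  have h : ∀ k, k ≤ numStarted M s o len σ ((u + 1) * k) := by
    intro k
    induction k with
    | zero => simp
    | succ k ih =>
      have := numStarted_lt_numStarted_add M s o len σ hM ho hlen ((u + 1) * k)
        ((hcon _).trans_lt j.2)
      rw [mul_add, mul_one]
      omega
  have h1 := h (j + 1)
  have h2 := hcon ((u + 1) * (j + 1))
  omega

/-- The run in terms of the start times `st 0 ≤ st 1 ≤ …` along the queue: all requests are started,
the memory constraint holds in the projection made at each time, and as long as a request is waiting
after the decisions of time `t`, the first such request would violate the constraint if it were
started at time `t`. -/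
theorem exists_schedule {u : ℕ} (hM : s + u ≤ M) (ho : ∀ i, 1 ≤ o i ∧ o i ≤ u)
    (hlen : ∀ i, len i ≤ u) :
    ∃ st : Fin n → ℕ, Monotone st ∧
      (∀ j, startTime M s o len (List.ofFn σ) (σ j) = st j) ∧
      (∀ t x, t < x → ∑ j, (if st j ≤ t ∧ t < st j + o (σ j) then
        memory s (len (σ j)) (st j) x else 0) ≤ M) ∧
      (∀ t j, t < st j → (∀ i < j, st i ≤ t) → ∃ x, t < x ∧
        M < ∑ i, (if st i ≤ t ∧ t < st i + o (σ i) then memory s (len (σ i)) (st i) x else 0) +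
          memory s (len (σ j)) t x) := by
  have hmono := numStarted_mono M s o len σ
  have hex : ∀ j : Fin n, ∃ p, numStarted M s o len σ p ≤ (j : ℕ) ∧
      (j : ℕ) < numStarted M s o len σ (p + 1) := fun j => by
    obtain ⟨t, ht⟩ := exists_lt_numStarted M s o len σ hM ho hlen j
    obtain ⟨p, -, hp⟩ := exists_start M s o len σ t j ht
    exact ⟨p, hp⟩
  choose st h1 h2 using hex
  have hlt : ∀ j t, st j < t ↔ (j : ℕ) < numStarted M s o len σ t := fun j t => by
    constructor
    · intro h
      exact (h2 j).trans_le (hmono h)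
    · intro h
      by_contra! h'
      exact absurd ((h1 j).trans_lt h) (not_lt.2 (hmono h'))
  have hact : ∀ t x, activeMemory s o len (run M s o len (List.ofFn σ) (t + 1)) t x =
      ∑ j, (if st j ≤ t ∧ t < st j + o (σ j) then memory s (len (σ j)) (st j) x else 0) := by
    intro t x
    unfold activeMemory
    rw [← Equiv.sum_comp σ]
    refine Finset.sum_congr rfl fun j _ => ?_
    by_cases h : st j ≤ t
    · rw [run_eq_some M s o len σ _ (st j) j (Nat.lt_succ_of_le h) (h1 j) (h2 j)]
      simp [h]
    · rw [(run_eq_none_iff M s o len σ _ j).2 (not_lt.1 fun h' => h ?_)]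
      · simp [h]
      · exact Nat.lt_succ_iff.1 ((hlt j _).2 h')
  refine ⟨st, ?_, ?_, ?_, ?_⟩
  · intro i j hij
    have := (hlt i (st j + 1)).2 (lt_of_le_of_lt hij (h2 j))
    omega
  · intro j
    refine le_antisymm (iInf₂_le (st j) ((mem_batch_run_iff M s o len σ _ j).2 ⟨h1 j, h2 j⟩)) ?_
    refine le_iInf₂ fun t ht => ?_
    have := (hlt j (t + 1)).2 ((mem_batch_run_iff M s o len σ _ j).1 ht).2
    exact_mod_cast Nat.lt_succ_iff.1 this
  · intro t x hx
    rw [← hact]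
    exact activeMemory_run_self_le M s o len σ (fun i => (ho i).1) t x hx
  · intro t j hj hi
    have hle : numStarted M s o len σ (t + 1) ≤ j := by
      by_contra! h
      exact absurd ((hlt j _).2 h) (by omega)
    have hj' : (j : ℕ) = numStarted M s o len σ (t + 1) := by
      refine le_antisymm ?_ hle
      by_contra! h
      have := (hlt ⟨numStarted M s o len σ (t + 1), by omega⟩ (t + 1)).1
        (Nat.lt_succ_of_le (hi _ (Fin.lt_def.2 h)))
      simp at this
    obtain ⟨x, hx, h⟩ := exists_lt_activeMemory M s o len σ (fun i => (ho i).1) t j hj'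
    exact ⟨x, hx, by rwa [hact] at h⟩

end Run

/-! ### Waiting times when `N` requests are always in process -/

section ListScheduling

/-- As long as one of the first `m` requests is waiting, `N` requests before it are in process. So
at each time there are at least as many uncompleted requests among the first `m - N` as there are
waiting ones among the first `m`. -/
theorem card_waiting_le {m N : ℕ} (p o : ℕ → ℕ) (t : ℕ)
    (h : ∀ j < m, t < p j → N ≤ ((Finset.range j).filter fun i => p i ≤ t ∧ t < p i + o i).card) :
    ((Finset.range m).filter fun j => t < p j).card ≤
      ((Finset.range (m - N)).filter fun j => t < p j + o j).card := by
  rcases ((Finset.range m).filter fun j => t < p j).eq_empty_or_nonempty with h0 | ⟨j, hj⟩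
  · simp [h0]
  rw [Finset.mem_filter, Finset.mem_range] at hj
  have hA := h j hj.1 hj.2
  set W := (Finset.range m).filter fun j => t < p j with hW
  set A := (Finset.range j).filter fun i => p i ≤ t ∧ t < p i + o i with hAdef
  have hdisj : Disjoint W A := by
    rw [Finset.disjoint_left]
    intro i hi hi'
    simp only [hW, hAdef, Finset.mem_filter] at hi hi'
    omega
  have hsub : W ∪ A ⊆ ((Finset.range (m - N)).filter fun j => t < p j + o j) ∪
      Finset.Ico (m - N) m := by
    intro i hi
    simp only [hW, hAdef, Finset.mem_filter, Finset.mem_union, Finset.mem_range,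
      Finset.mem_Ico] at hi ⊢
    omega
  have h1 := (Finset.card_le_card hsub).trans (Finset.card_union_le _ _)
  rw [Finset.card_union_of_disjoint hdisj, Nat.card_Ico] at h1
  omega

theorem card_filter_range_lt {T a : ℕ} (h : a ≤ T) :
    ((Finset.range T).filter fun t => t < a).card = a := by
  have : ((Finset.range T).filter fun t => t < a) = Finset.range a := by
    ext t
    simp
    omega
  rw [this, Finset.card_range]

theorem sum_start_le_sum_completion {m N : ℕ} (p o : ℕ → ℕ)
    (h : ∀ j < m, ∀ t < p j,
      N ≤ ((Finset.range j).filter fun i => p i ≤ t ∧ t < p i + o i).card) :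
    ∑ j ∈ Finset.range m, p j ≤ ∑ j ∈ Finset.range (m - N), (p j + o j) := by
  set T := ∑ j ∈ Finset.range m, (p j + o j) with hT
  have hle : ∀ j ∈ Finset.range m, p j + o j ≤ T := fun j hj =>
    Finset.single_le_sum (f := fun j => p j + o j) (fun _ _ => Nat.zero_le _) hj
  have h1 : ∑ j ∈ Finset.range m, p j =
      ∑ t ∈ Finset.range T, ((Finset.range m).filter fun j => t < p j).card := by
    simp only [Finset.card_filter]
    rw [Finset.sum_comm]
    refine Finset.sum_congr rfl fun j hj => ?_
    rw [← Finset.card_filter, card_filter_range_lt ((Nat.le_add_right _ _).trans (hle j hj))]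
  have h2 : ∑ j ∈ Finset.range (m - N), (p j + o j) =
      ∑ t ∈ Finset.range T, ((Finset.range (m - N)).filter fun j => t < p j + o j).card := by
    simp only [Finset.card_filter]
    rw [Finset.sum_comm]
    refine Finset.sum_congr rfl fun j hj => ?_
    rw [← Finset.card_filter,
      card_filter_range_lt (hle j (Finset.range_mono (Nat.sub_le _ _) hj))]
  rw [h1, h2]
  exact Finset.sum_le_sum fun t _ => card_waiting_le p o t fun j hj ht => h j hj t ht

/-- If `N` earlier requests are in process whenever a request is waiting, the total waiting time is
at most that of the schedule on `N` machines to which the requests are dealt cyclically: there,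
`⌊(n - 1 - j) / N⌋` requests wait for the request at position `j`. -/
theorem sum_start_le {n N : ℕ} (hN : 0 < N) (p o : ℕ → ℕ)
    (h : ∀ j < n, ∀ t < p j,
      N ≤ ((Finset.range j).filter fun i => p i ≤ t ∧ t < p i + o i).card) :
    ∑ j ∈ Finset.range n, p j ≤ ∑ j ∈ Finset.range n, (n - 1 - j) / N * o j := by
  induction n using Nat.strong_induction_on with
  | _ n ih =>
    rcases le_or_gt n N with hn | hn
    · have := sum_start_le_sum_completion p o h
      rw [Nat.sub_eq_zero_of_le hn, Finset.sum_range_zero] at this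
      omega
    · have ih' := ih (n - N) (by omega) fun j hj => h j (by omega)
      calc ∑ j ∈ Finset.range n, p j
          ≤ ∑ j ∈ Finset.range (n - N), (p j + o j) := sum_start_le_sum_completion p o h
        _ ≤ ∑ j ∈ Finset.range (n - N), (n - N - 1 - j) / N * o j +
            ∑ j ∈ Finset.range (n - N), o j := by
          rw [Finset.sum_add_distrib]
          exact Nat.add_le_add_right ih' _
        _ = ∑ j ∈ Finset.range (n - N), (n - 1 - j) / N * o j := by
          rw [← Finset.sum_add_distrib]
          refine Finset.sum_congr rfl fun j hj => ?_
          rw [Finset.mem_range] at hj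
          rw [show n - 1 - j = n - N - 1 - j + N by omega, Nat.add_div_right _ hN, Nat.succ_mul]
        _ ≤ ∑ j ∈ Finset.range n, (n - 1 - j) / N * o j :=
          Finset.sum_le_sum_of_subset (Finset.range_mono (Nat.sub_le _ _))

end ListScheduling

/-! ### Sums of `⌊j / K⌋` -/

section Arithmetic

/-- The sum of `⌊j / K⌋` over `j < m`: the total waiting time of `m` requests of unit length that
are served in batches of `K`. -/
def batchWait (K m : ℕ) : ℕ := ∑ j ∈ Finset.range m, j / K

theorem batchWait_mono (K : ℕ) : Monotone (batchWait K) := fun _ _ h =>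
  Finset.sum_le_sum_of_subset (Finset.range_mono h)

theorem batchWait_of_le {K m : ℕ} (h : m ≤ K) : batchWait K m = 0 :=
  Finset.sum_eq_zero fun _ hj => Nat.div_eq_of_lt ((Finset.mem_range.1 hj).trans_le h)

theorem batchWait_add {K : ℕ} (hK : 0 < K) (m : ℕ) :
    batchWait K (m + K) = m + batchWait K m := by
  unfold batchWait
  rw [add_comm m K, Finset.sum_range_add, Finset.sum_eq_zero, zero_add]
  · simp [Nat.add_div_left _ hK, Finset.sum_add_distrib, add_comm]
  · exact fun _ hj => Nat.div_eq_of_lt (Finset.mem_range.1 hj)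

theorem batchWait_le {K : ℕ} (hK : 0 < K) (m : ℕ) :
    batchWait K m ≤ (m - K) + batchWait K (m - K) := by
  rcases le_total m K with h | h
  · simp [batchWait_of_le h]
  · rw [← batchWait_add hK, Nat.sub_add_cancel h]

theorem two_mul_batchWait {K : ℕ} (hK : 0 < K) (q f : ℕ) (hf : f ≤ K) :
    (2 * batchWait K (q * K + f) : ℤ) = q * (q - 1) * K + 2 * q * f := by
  induction q with
  | zero => simp [batchWait_of_le hf]
  | succ q ih =>
    rw [show (q + 1) * K + f = (q * K + f) + K by ring, batchWait_add hK]
    push_cast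
    linear_combination ih

theorem exists_eq_mul_add {K : ℕ} (hK : 0 < K) (n : ℕ) : ∃ q f, f ≤ K ∧ n = q * K + f :=
  ⟨n / K, n % K, (Nat.mod_lt n hK).le, by rw [mul_comm, Nat.div_add_mod]⟩

theorem batchWait_upper {K : ℕ} (hK : 0 < K) (n : ℕ) :
    (8 * K * (n + batchWait K n) : ℤ) ≤ (2 * n + K) ^ 2 := by
  obtain ⟨q, f, hf, rfl⟩ := exists_eq_mul_add hK n
  have h := two_mul_batchWait hK q f hf
  push_cast
  have : (8 * K * ((q * K + f) + batchWait K (q * K + f)) : ℤ) =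
      8 * K * (q * K + f) + 4 * K * (q * (q - 1) * K + 2 * q * f) := by
    rw [← h]
    ring
  rw [this]
  nlinarith [sq_nonneg (2 * (f : ℤ) - K)]

theorem batchWait_lower {K : ℕ} (hK : 0 < K) (n : ℕ) :
    ((n : ℤ) ^ 2 - n * K) ≤ 2 * K * batchWait K n := by
  obtain ⟨q, f, hf, rfl⟩ := exists_eq_mul_add hK n
  have h := two_mul_batchWait hK q f hf
  have : (2 * K * batchWait K (q * K + f) : ℤ) = K * (q * (q - 1) * K + 2 * q * f) := by
    rw [← h]
    ring
  rw [this]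
  push_cast
  have hf' : (f : ℤ) ≤ K := by exact_mod_cast hf
  nlinarith [mul_nonneg (Int.natCast_nonneg f) (sub_nonneg.2 hf')]

/-- `K ∑_{j < n} (⌊j / K⌋ + 1)` is the sum of the numbers `1, …, n` rounded up to multiples of `K`;
it increases with `K`. -/
theorem mul_batchWait_mono {N K : ℕ} (hN : 0 < N) (hNK : N ≤ K) (n : ℕ) :
    N * (n + batchWait N n) ≤ K * (n + batchWait K n) := by
  have hK : 0 < K := hN.trans_le hNK
  have e1 := Nat.div_add_mod n N
  have e2 := Nat.div_add_mod n K
  have l1 := Nat.mod_lt n hN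
  have l2 := Nat.mod_lt n hK
  have hq : n / K ≤ n / N := Nat.div_le_div_left hNK hN
  generalize n / N = q at *
  generalize n % N = f at *
  generalize n / K = q' at *
  generalize n % K = f' at *
  have h1 := two_mul_batchWait hN q f l1.le
  have h2 := two_mul_batchWait hK q' f' l2.le
  rw [mul_comm q N, e1] at h1
  rw [mul_comm q' K, e2] at h2
  zify at *
  suffices H : (q + 1) * (N : ℤ) * (2 * n - q * N) ≤ (q' + 1) * K * (2 * n - q' * K) by
    have k1 : (2 * (N * (n + batchWait N n)) : ℤ) = (q + 1) * (N : ℤ) * (2 * n - q * N) := by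
      have : (2 * (N * (n + batchWait N n)) : ℤ) = N * (2 * n + 2 * batchWait N n) := by ring
      rw [this, h1, ← e1]
      ring
    have k2 : (2 * (K * (n + batchWait K n)) : ℤ) = (q' + 1) * (K : ℤ) * (2 * n - q' * K) := by
      have : (2 * (K * (n + batchWait K n)) : ℤ) = K * (2 * n + 2 * batchWait K n) := by ring
      rw [this, h2, ← e2]
      ring
    linarith
  have hq0 : (0 : ℤ) ≤ q := Int.natCast_nonneg _
  have hq0' : (0 : ℤ) ≤ q' := Int.natCast_nonneg _
  have hf0 : (0 : ℤ) ≤ f := Int.natCast_nonneg _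
  have hf0' : (0 : ℤ) ≤ f' := Int.natCast_nonneg _
  generalize (q : ℤ) = q at *
  generalize (q' : ℤ) = q' at *
  generalize (f : ℤ) = f at *
  generalize (f' : ℤ) = f' at *
  generalize (n : ℤ) = n at *
  generalize (N : ℤ) = N at *
  generalize (K : ℤ) = K at *
  clear h1 h2
  rcases le_total ((q + 1) * N) ((q' + 1) * K) with hb | hb
  · -- The map `b ↦ b (2 n - θ b)` with `θ = q' / (q' + 1)` increases as long as `θ b ≤ n`.
    have hpos : 0 < q' + 1 := by omega
    refine le_of_mul_le_mul_left ?_ hpos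
    have t1 : q' * ((q + 1) * N) ≤ (q' + 1) * (q * N) := by nlinarith
    have t2 : q' * ((q' + 1) * K) ≤ (q' + 1) * n := by nlinarith
    have hb0 : 0 ≤ (q + 1) * N := by positivity
    have t3 : q' * ((q + 1) * N) ≤ q' * ((q' + 1) * K) := mul_le_mul_of_nonneg_left hb hq0'
    have t4 := mul_nonneg (sub_nonneg.2 hb)
      (show 0 ≤ 2 * n * (q' + 1) - q' * ((q' + 1) * K + (q + 1) * N) by linarith)
    have t5 := mul_le_mul_of_nonneg_left t1 hb0
    linarith
  · -- Here `d` measures by how much the block end for `N` exceeds that for `K`.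
    obtain ⟨d, hd⟩ : ∃ d, (q + 1) * N = (q' + 1) * K + d := ⟨_, (add_sub_cancel _ _).symm⟩
    obtain ⟨w, hw⟩ : ∃ w, K = N + w := ⟨_, (add_sub_cancel _ _).symm⟩
    have hd0 : 0 ≤ d := by linarith
    have hw0 : 0 ≤ w := by linarith
    subst hw
    have hfd : f ≤ N - d := by linarith
    have hdw : d * (N - d) ≤ (q' + 1) * (N + w) * w := by
      rcases hq.eq_or_lt with rfl | hlt
      · have : 0 ≤ (q' + 1) * w := by positivity
        obtain rfl : d = 0 := by linarith
        simp only [zero_mul]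
        positivity
      · have h1 : N ≤ (q - q') * N := le_mul_of_one_le_left hN.le (by omega)
        have h2 : N - d ≤ (q' + 1) * w := by linarith
        calc d * (N - d) ≤ (N + w) * (N - d) :=
              mul_le_mul_of_nonneg_right (by linarith) (by linarith)
          _ ≤ (N + w) * ((q' + 1) * w) := mul_le_mul_of_nonneg_left h2 hK.le
          _ = (q' + 1) * (N + w) * w := by ring
    have t1 : d * f ≤ d * (N - d) := mul_le_mul_of_nonneg_left hfd hd0
    have t2 : d * n ≤ d * ((q' + 1) * (N + w)) := mul_le_mul_of_nonneg_left (by linarith) hd0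
    have ha : q * N = q' * (N + w) + w + d := by linarith
    have e3 : 2 * n - q * N = n + f := by linarith
    have e4 : 2 * n - q' * (N + w) = n + f + w + d := by linarith
    rw [hd, e3, e4]
    linarith

/-- The averaging inequality behind the factor `(1 + α⁻¹) / 2`: here `y` of the `n` requests are
long. -/
theorem two_mul_mul_batchWait_le {K : ℕ} (hK : 0 < K) {n y : ℕ} (hy : y ≤ n) :
    2 * y * (n + batchWait K n) ≤ n * (n + batchWait K n) + 2 * n * (y + batchWait K (y - K)) := by
  have hB := batchWait_upper hK n
  have hE := batchWait_lower hK (y - K)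
  rcases le_total (2 * y) n with h | h
  · exact (Nat.mul_le_mul_right _ h).trans (Nat.le_add_right _ _)
  rcases le_total n K with hnK | hnK
  · rw [batchWait_of_le hnK]
    nlinarith
  have hK0 : (0 : ℤ) < K := by exact_mod_cast hK
  rcases le_total y K with hyK | hyK
  · rw [Nat.sub_eq_zero_of_le hyK] at *
    zify at *
    clear hE
    have hE0 : (0 : ℤ) ≤ batchWait K 0 := Int.natCast_nonneg _
    have hy0 : (0 : ℤ) ≤ y := Int.natCast_nonneg _
    generalize (batchWait K n : ℤ) = B at *
    generalize (batchWait K 0 : ℤ) = E at *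
    have h1 : (2 * n + K : ℤ) ^ 2 ≤ 16 * K * n := by
      nlinarith [mul_nonneg (sub_nonneg.2 hnK) (show (0 : ℤ) ≤ 2 * K - n by linarith)]
    have h2 : (2 * y - n : ℤ) * (8 * K * (n + B)) ≤ y * (16 * K * n) :=
      calc (2 * y - n : ℤ) * (8 * K * (n + B)) ≤ (2 * y - n) * (16 * K * n) :=
            mul_le_mul_of_nonneg_left (hB.trans h1) (by linarith)
        _ ≤ y * (16 * K * n) := mul_le_mul_of_nonneg_right (by linarith) (by positivity)
    have h3 : (2 * y - n : ℤ) * (n + B) ≤ 2 * n * y :=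
      le_of_mul_le_mul_left (by linarith) (show (0 : ℤ) < 8 * K by linarith)
    have h4 : (0 : ℤ) ≤ n * E := by positivity
    linarith
  · obtain ⟨d, rfl⟩ : ∃ d : ℕ, n = y + d := ⟨n - y, by omega⟩
    rw [Nat.cast_sub hyK] at hE
    zify at *
    have hd0 : (0 : ℤ) ≤ d := Int.natCast_nonneg _
    have hy0 : (0 : ℤ) ≤ y := Int.natCast_nonneg _
    generalize (batchWait K (y + d) : ℤ) = B at *
    generalize (batchWait K (y - K) : ℤ) = E at *
    generalize (K : ℤ) = K at *
    generalize (y : ℤ) = y at *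
    generalize (d : ℤ) = d at *
    have key : (y - d) * (2 * (y + d) + K) ^ 2 ≤ 8 * (y + d) * (y ^ 2 - y * K + 2 * K ^ 2) := by
      have h1 : 0 ≤ y * ((2 * y - 3 * K) ^ 2 + 6 * K ^ 2) + d * (4 * (y - K) ^ 2 + 13 * K ^ 2) +
          d ^ 2 * (4 * (y + K)) + 4 * d ^ 3 := by positivity
      linarith
    have h1 : y ^ 2 - y * K + 2 * K ^ 2 ≤ 2 * K * (y + E) := by linarith
    have h2 : (y - d) * (8 * K * (y + d + B)) ≤ 8 * (y + d) * (2 * K * (y + E)) :=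
      (mul_le_mul_of_nonneg_left hB (by linarith)).trans
        (key.trans (mul_le_mul_of_nonneg_left h1 (by linarith)))
    have h3 : (y - d) * (y + d + B) ≤ 2 * (y + d) * (y + E) :=
      le_of_mul_le_mul_left (by linarith) (show (0 : ℤ) < 8 * K by linarith)
    linarith

end Arithmetic

/-! ### Generations of a shortest-first schedule -/

section ShortestFirst

/-- The start times `st 0 ≤ st 1 ≤ …` of `n` requests with output lengths `oo 0 ≤ oo 1 ≤ …` in a
greedy schedule: the memory constraint holds at all times, and the first request that waits after
the decisions of time `t` could not have been started at time `t`. Only the values of `oo` and `st`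
below `n` matter; beyond, `oo` is any monotone extension. -/
structure IsShortestFirst (n M s ℓ u : ℕ) (oo st : ℕ → ℕ) : Prop where
  pos : 0 < ℓ
  mono : Monotone oo
  le_length : ∀ j, ℓ ≤ oo j
  length_le : ∀ j, oo j ≤ u
  start_mono : ∀ i j, i ≤ j → j < n → st i ≤ st j
  feasible : ∀ x, ∑ j ∈ Finset.range n, memory s (oo j) (st j) x ≤ M
  maximal : ∀ t j, j < n → t < st j → (∀ i < j, st i ≤ t) → ∃ x, t < x ∧
    M < ∑ i ∈ Finset.range n, (if st i ≤ t then memory s (oo i) (st i) x else 0) +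
      memory s (oo j) t x

/-- The number of requests started before time `T`. -/
def startedBefore (n : ℕ) (st : ℕ → ℕ) (T : ℕ) : ℕ :=
  ((Finset.range n).filter fun j => st j < T).card

/-- The time at which generation `k` begins. It lasts for the output length of the shortest request
that is not yet started at this time. -/
def genStart (n : ℕ) (oo st : ℕ → ℕ) : ℕ → ℕ
  | 0 => 0
  | k + 1 => genStart n oo st k + oo (startedBefore n st (genStart n oo st k))

/-- The late requests of generation `k`: those started less than `ℓ` before its end. -/
def late (n ℓ : ℕ) (oo st : ℕ → ℕ) (k : ℕ) : Finset ℕ :=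
  (Finset.range n).filter fun j =>
    genStart n oo st (k + 1) < st j + ℓ ∧ st j < genStart n oo st (k + 1)

theorem startedBefore_mono (n : ℕ) (st : ℕ → ℕ) : Monotone (startedBefore n st) := fun _ _ h =>
  Finset.card_le_card (Finset.monotone_filter_right _ fun _ _ hj => lt_of_lt_of_le hj h)

theorem exists_gen (n : ℕ) (oo st : ℕ → ℕ) (k : ℕ) {j : ℕ} (hj : st j < genStart n oo st k) :
    ∃ i < k, genStart n oo st i ≤ st j ∧ st j < genStart n oo st (i + 1) := by
  induction k with
  | zero => simp [genStart] at hj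
  | succ k ih =>
    by_cases hlt : st j < genStart n oo st k
    · obtain ⟨i, hi, h'⟩ := ih hlt
      exact ⟨i, by omega, h'⟩
    · exact ⟨k, by omega, not_lt.1 hlt, hj⟩

theorem sum_length_mul_le_sum_start (n : ℕ) (oo st : ℕ → ℕ) (L : ℕ) :
    ∑ k ∈ Finset.range L, oo (startedBefore n st (genStart n oo st k)) *
        (n - startedBefore n st (genStart n oo st (k + 1))) ≤ ∑ j ∈ Finset.range n, st j := by
  have h1 : ∀ k, n - startedBefore n st (genStart n oo st (k + 1)) =
      ∑ j ∈ Finset.range n, if genStart n oo st (k + 1) ≤ st j then 1 else 0 := by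
    intro k
    have := Finset.card_filter_add_card_filter_not (s := Finset.range n)
      (fun j => st j < genStart n oo st (k + 1))
    rw [Finset.card_range] at this
    rw [← Finset.card_filter, startedBefore]
    simp only [not_lt] at this
    omega
  simp only [h1, Finset.mul_sum]
  rw [Finset.sum_comm]
  refine Finset.sum_le_sum fun j _ => ?_
  have key : ∀ L, ∑ k ∈ Finset.range L, oo (startedBefore n st (genStart n oo st k)) *
      (if genStart n oo st (k + 1) ≤ st j then 1 else 0) ≤ min (st j) (genStart n oo st L) := by
    intro L
    induction L with
    | zero => simp
    | succ L ih =>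
      rw [Finset.sum_range_succ]
      have : genStart n oo st (L + 1) = genStart n oo st L +
        oo (startedBefore n st (genStart n oo st L)) := rfl
      split_ifs <;> omega
  exact (key L).trans (min_le_left _ _)

namespace IsShortestFirst

variable {n M s ℓ u : ℕ} {oo st : ℕ → ℕ} (h : IsShortestFirst n M s ℓ u oo st)

include h

theorem lt_startedBefore_iff {j : ℕ} (hj : j < n) (T : ℕ) :
    j < startedBefore n st T ↔ st j < T := by
  constructor
  · intro hlt
    by_contra! hT
    have hsub : ((Finset.range n).filter fun i => st i < T) ⊆ Finset.range j := by
      intro i hi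
      rw [Finset.mem_filter, Finset.mem_range] at hi
      rw [Finset.mem_range]
      by_contra! hij
      exact absurd (h.start_mono j i hij hi.1) (by omega)
    have := Finset.card_le_card hsub
    rw [Finset.card_range] at this
    exact absurd hlt (not_lt.2 this)
  · intro hT
    have hsub : Finset.range (j + 1) ⊆ ((Finset.range n).filter fun i => st i < T) := by
      intro i hi
      rw [Finset.mem_range] at hi
      rw [Finset.mem_filter, Finset.mem_range]
      exact ⟨by omega, (h.start_mono i j (by omega) hj).trans_lt hT⟩
    have := Finset.card_le_card hsub
    rwa [Finset.card_range] at this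

theorem genStart_add_le (k : ℕ) : genStart n oo st k + ℓ ≤ genStart n oo st (k + 1) :=
  Nat.add_le_add_left (h.le_length _) _

theorem genStart_add_nat_le (k d : ℕ) : genStart n oo st k + d ≤ genStart n oo st (k + d) := by
  induction d with
  | zero => exact le_rfl
  | succ d ih =>
    have := h.genStart_add_le (k + d)
    have := h.pos
    rw [← add_assoc, ← add_assoc]
    omega

theorem genStart_mono : Monotone (genStart n oo st) :=
  monotone_nat_of_le_succ fun k => (Nat.le_add_right _ _).trans (h.genStart_add_le k)

/-- No request is completed within its own generation. -/
theorem genStart_succ_le_completion {k j : ℕ} (hj : j < n) (hk : genStart n oo st k ≤ st j) :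
    genStart n oo st (k + 1) ≤ st j + oo j := by
  have h1 : startedBefore n st (genStart n oo st k) ≤ j := by
    by_contra! hlt
    exact absurd ((h.lt_startedBefore_iff hj _).1 hlt) (by omega)
  exact Nat.add_le_add hk (h.mono h1)

/-- A request of generation `i` that is not late is completed at least `ℓ` before the end of
generation `i + 1`. -/
theorem completion_add_le {i j : ℕ} (hj : j < n) (hi : st j + ℓ ≤ genStart n oo st (i + 1)) :
    st j + oo j + ℓ ≤ genStart n oo st (i + 2) := by
  have h0 := h.pos
  have h1 : oo j ≤ oo (startedBefore n st (genStart n oo st (i + 1))) :=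
    h.mono ((h.lt_startedBefore_iff hj _).2 (by omega)).le
  rw [show genStart n oo st (i + 2) = genStart n oo st (i + 1) +
    oo (startedBefore n st (genStart n oo st (i + 1))) from rfl]
  omega

/-- Of the earlier generations, only late requests are still in process when the late period of
generation `k` begins, and only those of the last `u` generations. -/
theorem card_old_le {k Q : ℕ} (hQ : ∀ i < k, (late n ℓ oo st i).card ≤ Q) :
    ((Finset.range n).filter fun j => st j < genStart n oo st k ∧
      genStart n oo st (k + 1) < st j + oo j + ℓ).card ≤ u * Q := by
  have hsub : ((Finset.range n).filter fun j => st j < genStart n oo st k ∧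
      genStart n oo st (k + 1) < st j + oo j + ℓ) ⊆
      (Finset.Ico (k - u) k).biUnion (late n ℓ oo st) := by
    intro j hj
    rw [Finset.mem_filter, Finset.mem_range] at hj
    obtain ⟨hjn, hjk, hjc⟩ := hj
    obtain ⟨i, hik, h1, h2⟩ := exists_gen n oo st k hjk
    rw [Finset.mem_biUnion]
    refine ⟨i, ?_, ?_⟩
    · rw [Finset.mem_Ico]
      refine ⟨?_, hik⟩
      by_contra! hlt
      have h3 := h.genStart_add_nat_le (i + 1) u
      have h4 := h.genStart_mono (show i + 1 + u ≤ k by omega)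
      have h5 := h.genStart_add_le k
      have h6 := h.length_le j
      omega
    · rw [late, Finset.mem_filter, Finset.mem_range]
      refine ⟨hjn, ?_, h2⟩
      by_contra! hle
      have h3 := h.completion_add_le hjn hle
      have h4 := h.genStart_mono (show i + 2 ≤ k + 1 by omega)
      omega
  refine (Finset.card_le_card hsub).trans ((Finset.card_biUnion_le_card_mul _ _ Q ?_).trans ?_)
  · intro i hi
    exact hQ i (Finset.mem_Ico.1 hi).2
  · rw [Nat.card_Ico]
    exact Nat.mul_le_mul_right _ (by omega)

/-- A generation has few late requests. At the beginning of the late period some later time `x` is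
almost fully booked. If `x` lies before the end of the generation, then the end is fully booked as
well, since in between only the few late requests of earlier generations release memory, while the
many requests of the generation grow. -/
theorem card_late_le (hM : (u * (s + u) * (s + u) + u * (s + u) + 1) * (s + u) ≤ M) (k : ℕ) :
    (late n ℓ oo st k).card ≤ s + u := by
  induction k using Nat.strong_induction_on with
  | _ k ih =>
    have hpos := h.pos
    have hZ := h.card_old_le ih
    have hgs := h.genStart_add_le k
    obtain ⟨y, hy⟩ : ∃ y, y = genStart n oo st (k + 1) := ⟨_, rfl⟩
    obtain ⟨b, hb⟩ : ∃ b, b + ℓ = y := ⟨y - ℓ, by omega⟩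
    have hmem : ∀ {j}, j ∈ late n ℓ oo st k ↔ j < n ∧ b < st j ∧ st j < y := by
      intro j
      rw [late, Finset.mem_filter, Finset.mem_range, ← hy]
      omega
    rcases (late n ℓ oo st k).eq_empty_or_nonempty with h0 | hne
    · simp [h0]
    -- The first request started after time `b` is late.
    set j₀ := (late n ℓ oo st k).min' hne with hj₀
    have hj₀m := hmem.1 ((late n ℓ oo st k).min'_mem hne)
    rw [← hj₀] at hj₀m
    obtain ⟨hj₀n, hj₀b, hj₀y⟩ := hj₀m
    have hmin : ∀ j ∈ late n ℓ oo st k, j₀ ≤ j := fun j hj => Finset.min'_le _ j hj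
    have hbefore : ∀ i < j₀, st i ≤ b := by
      intro i hi
      by_contra! hlt
      have := hmin i (hmem.2 ⟨by omega, hlt, (h.start_mono i j₀ hi.le hj₀n).trans_lt hj₀y⟩)
      omega
    obtain ⟨x, hbx, hx⟩ := h.maximal b j₀ hj₀n hj₀b hbefore
    have hxle : x ≤ b + oo j₀ := by
      by_contra! hlt
      have h1 : memory s (oo j₀) b x = 0 := if_neg (by omega)
      rw [h1, add_zero] at hx
      refine absurd hx (not_lt.2 (le_trans (Finset.sum_le_sum fun j _ => ?_) (h.feasible x)))
      split_ifs <;> simp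
    have hm₀ : memory s (oo j₀) b x ≤ s + u := by
      have := h.length_le j₀
      unfold memory
      split_ifs <;> omega
    -- Whenever the requests started by time `b` nearly fill the cache at a time at which the late
    -- requests are in process, the latter are few.
    have hfull : ∀ z, M < ∑ i ∈ Finset.range n, (if st i ≤ b then memory s (oo i) (st i) z else 0) +
        (s + u) → (∀ j ∈ late n ℓ oo st k, st j < z ∧ z ≤ st j + oo j) →
        (late n ℓ oo st k).card ≤ s + u := by
      intro z hz hact
      have h1 : ∑ i ∈ Finset.range n, (if st i ≤ b then memory s (oo i) (st i) z else 0) +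
          ((Finset.range n).filter fun j => j ∈ late n ℓ oo st k).card ≤ M := by
        refine le_trans ?_ (h.feasible z)
        rw [Finset.card_filter, ← Finset.sum_add_distrib]
        refine Finset.sum_le_sum fun j _ => ?_
        by_cases hj : j ∈ late n ℓ oo st k
        · have h2 := hact j hj
          have h3 := (hmem.1 hj).2.1
          rw [if_neg (by omega), if_pos hj, memory, if_pos h2]
          omega
        · rw [if_neg hj]
          split_ifs <;> simp
      rw [Finset.filter_mem_eq_inter, Finset.inter_eq_right.2
        (show late n ℓ oo st k ⊆ _ from Finset.filter_subset _ _)] at h1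
      omega
    rcases le_or_gt y x with hyx | hxy
    · refine hfull x (by omega) fun j hj => ?_
      have h1 := h.mono (hmin j hj)
      have h2 := hmem.1 hj
      omega
    -- Compare the memory at the times `x < y`: `g` counts the requests of generation `k` begun by
    -- time `b`, and `z` the requests of earlier generations still in process after time `b`.
    refine hfull y ?_ fun j hj => ?_
    · set Z := (Finset.range n).filter fun j => st j < genStart n oo st k ∧
        genStart n oo st (k + 1) < st j + oo j + ℓ with hZdef
      set g := (Finset.range n).filter fun j => genStart n oo st k ≤ st j ∧ st j ≤ b with hg
      have h1 : ∑ i ∈ Finset.range n, (if st i ≤ b then memory s (oo i) (st i) x else 0) ≤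
          g.card * (s + u) + Z.card * (s + u) := by
        rw [hg, hZdef, Finset.card_filter, Finset.card_filter, Finset.sum_mul, Finset.sum_mul,
          ← Finset.sum_add_distrib]
        refine Finset.sum_le_sum fun j _ => ?_
        have := h.length_le j
        unfold memory
        split_ifs <;> omega
      have h2 : ∑ i ∈ Finset.range n, (if st i ≤ b then memory s (oo i) (st i) x else 0) +
          g.card ≤ ∑ i ∈ Finset.range n, (if st i ≤ b then memory s (oo i) (st i) y else 0) +
            Z.card * (s + u) := by
        rw [hg, hZdef, Finset.card_filter, Finset.card_filter, Finset.sum_mul,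
          ← Finset.sum_add_distrib, ← Finset.sum_add_distrib]
        refine Finset.sum_le_sum fun j hj => ?_
        have := h.length_le j
        by_cases hgen : genStart n oo st k ≤ st j
        · have := h.genStart_succ_le_completion (Finset.mem_range.1 hj) hgen
          unfold memory
          split_ifs <;> omega
        · unfold memory
          split_ifs <;> omega
      have h3 : Z.card * (s + u) ≤ u * (s + u) * (s + u) := Nat.mul_le_mul_right _ hZ
      have h4 : u * (s + u) * (s + u) ≤ g.card := by
        by_contra! hlt
        have h5 : (g.card + Z.card + 1) * (s + u) ≤
            (u * (s + u) * (s + u) + u * (s + u) + 1) * (s + u) :=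
          Nat.mul_le_mul_right _ (by omega)
        rw [add_mul, add_mul, one_mul] at h5
        omega
      omega
    · have h2 := hmem.1 hj
      have h3 := h.genStart_succ_le_completion (k := k) h2.1 (by omega)
      omega

/-- The requests of a generation that are not late are all in process at its end, and then hold
`s + ℓ` tokens each. -/
theorem startedBefore_genStart_succ_le
    (hM : (u * (s + u) * (s + u) + u * (s + u) + 1) * (s + u) ≤ M) (k : ℕ) :
    startedBefore n st (genStart n oo st (k + 1)) ≤
      startedBefore n st (genStart n oo st k) + (M / (s + ℓ) + s + u) := by
  have hpos := h.pos
  have hl := h.card_late_le hM k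
  set P := (Finset.range n).filter fun j => genStart n oo st k ≤ st j ∧
    st j + ℓ ≤ genStart n oo st (k + 1) with hP
  have h1 : P.card ≤ M / (s + ℓ) := by
    rw [Nat.le_div_iff_mul_le (by omega)]
    refine le_trans ?_ (h.feasible (genStart n oo st (k + 1)))
    rw [hP, Finset.card_filter, Finset.sum_mul]
    refine Finset.sum_le_sum fun j hj => ?_
    split_ifs with hj'
    · have := h.genStart_succ_le_completion (Finset.mem_range.1 hj) hj'.1
      rw [memory, if_pos (by omega)]
      omega
    · simp
  have hsub : ((Finset.range n).filter fun j => st j < genStart n oo st (k + 1)) ⊆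
      ((Finset.range n).filter fun j => st j < genStart n oo st k) ∪ (P ∪ late n ℓ oo st k) := by
    intro j hj
    simp only [hP, late, Finset.mem_union, Finset.mem_filter, Finset.mem_range] at hj ⊢
    omega
  have h2 := (Finset.card_le_card hsub).trans ((Finset.card_union_le _ _).trans
    (Nat.add_le_add_left (Finset.card_union_le _ _) _))
  unfold startedBefore
  omega

end IsShortestFirst

/-- If at most `K` requests are started per generation, the numbers of those left after each
generation add up to at least the total waiting time in full batches. -/
theorem batchWait_le_sum {K n : ℕ} (hK : 0 < K) (G : ℕ → ℕ) (hG : ∀ k, G (k + 1) ≤ G k + K)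
    (z d : ℕ) (hd : n ≤ G (z + d)) :
    batchWait K (n - G z) ≤ ∑ k ∈ Finset.Ico z (z + d), (n - G (k + 1)) := by
  induction d generalizing z with
  | zero =>
    rw [add_zero] at hd
    simp [Nat.sub_eq_zero_of_le hd, batchWait]
  | succ d ih =>
    rw [Finset.sum_eq_sum_Ico_succ_bot (by omega)]
    have h1 := ih (z + 1) (by rwa [add_assoc, add_comm 1])
    rw [show z + 1 + d = z + (d + 1) by ring] at h1
    have h2 := batchWait_le hK (n - G z)
    have h3 := hG z
    have h4 := batchWait_mono K (show n - G z - K ≤ n - G (z + 1) by omega)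
    omega

/-- The variant of `batchWait_le_sum` in which only the generations that begin after the first `x`
requests count. The first of them starts at most `K` positions later, which costs one batch. -/
theorem batchWait_le_sum_ite {K n : ℕ} (hK : 0 < K) (G : ℕ → ℕ) (hG : ∀ k, G (k + 1) ≤ G k + K)
    (hmono : Monotone G) (h0 : G 0 = 0) (L : ℕ) (hL : n ≤ G L) (x : ℕ) (hx : x ≤ n) :
    batchWait K (n - x - K) ≤ ∑ k ∈ Finset.range L, if x ≤ G k then n - G (k + 1) else 0 := by
  classical
  have hex : ∃ k, x ≤ G k := ⟨L, hx.trans hL⟩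
  set z := Nat.find hex with hz
  have hzx : x ≤ G z := Nat.find_spec hex
  have hzL : z ≤ L := Nat.find_min' hex (hx.trans hL)
  have hzK : G z ≤ x + K := by
    rcases Nat.eq_zero_or_pos z with h | h
    · rw [h]
      omega
    · have h1 := hG (z - 1)
      have h2 := Nat.find_min hex (show z - 1 < Nat.find hex by omega)
      rw [show z - 1 + 1 = z by omega] at h1
      omega
  calc batchWait K (n - x - K) ≤ batchWait K (n - G z) := batchWait_mono K (by omega)
    _ ≤ ∑ k ∈ Finset.Ico z (z + (L - z)), (n - G (k + 1)) :=
        batchWait_le_sum hK G hG z (L - z) (by rwa [Nat.add_sub_cancel' hzL])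
    _ = ∑ k ∈ Finset.Ico z L, if x ≤ G k then n - G (k + 1) else 0 := by
        rw [Nat.add_sub_cancel' hzL]
        refine Finset.sum_congr rfl fun k hk => ?_
        rw [if_pos (hzx.trans (hmono (Finset.mem_Ico.1 hk).1))]
    _ ≤ _ := Finset.sum_le_sum_of_subset (by
        intro k hk
        rw [Finset.mem_range]
        exact (Finset.mem_Ico.1 hk).2)

theorem eq_add_sum_ite {ℓ u a : ℕ} (h1 : ℓ ≤ a) (h2 : a ≤ u) :
    a = ℓ + ∑ v ∈ Finset.Ioc ℓ u, if v ≤ a then 1 else 0 := by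
  have : (Finset.Ioc ℓ u).filter (fun v => v ≤ a) = Finset.Ioc ℓ a := by
    ext v
    simp
    omega
  rw [← Finset.card_filter, this, Nat.card_Ioc]
  omega

/-- Lower bound on the total waiting time of a shortest-first schedule. The lengths of the
generations are decomposed into the `ℓ` levels that all of them reach and the levels above `ℓ`. -/
theorem IsShortestFirst.le_sum_start {n M s ℓ u : ℕ} {oo st : ℕ → ℕ}
    (h : IsShortestFirst n M s ℓ u oo st)
    (hM : (u * (s + u) * (s + u) + u * (s + u) + 1) * (s + u) ≤ M) :
    ℓ * batchWait (M / (s + ℓ) + s + u) n + ∑ v ∈ Finset.Ioc ℓ u,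
      batchWait (M / (s + ℓ) + s + u)
        (((Finset.range n).filter fun j => v ≤ oo j).card - (M / (s + ℓ) + s + u)) ≤
      ∑ j ∈ Finset.range n, st j := by
  have hpos := h.pos
  have hu := (h.le_length 0).trans (h.length_le 0)
  have hG := h.startedBefore_genStart_succ_le hM
  set K := M / (s + ℓ) + s + u with hKdef
  have hK : 0 < K := Nat.lt_of_lt_of_le (show 0 < u by omega) (Nat.le_add_left _ _)
  set G := fun k => startedBefore n st (genStart n oo st k) with hGdef
  have hmono : Monotone G := (startedBefore_mono n st).comp h.genStart_mono
  have h0 : G 0 = 0 := by simp [hGdef, startedBefore, genStart]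
  obtain ⟨L, hL⟩ : ∃ L, n ≤ G L := by
    refine ⟨∑ j ∈ Finset.range n, st j + 1, ?_⟩
    rcases Nat.eq_zero_or_pos n with rfl | hn
    · simp
    have h1 := (h.lt_startedBefore_iff (show n - 1 < n by omega)
      (genStart n oo st (∑ j ∈ Finset.range n, st j + 1))).2 (by
        have h2 := h.genStart_add_nat_le 0 (∑ j ∈ Finset.range n, st j + 1)
        have h3 : st (n - 1) ≤ ∑ j ∈ Finset.range n, st j :=
          Finset.single_le_sum (fun _ _ => Nat.zero_le _) (Finset.mem_range.2 (by omega))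
        rw [zero_add] at h2
        omega)
    simp only [hGdef]
    omega
  refine le_trans ?_ (sum_length_mul_le_sum_start n oo st L)
  have h1 : batchWait K n ≤ ∑ k ∈ Finset.range L, (n - G (k + 1)) := by
    have := batchWait_le_sum (n := n) hK G hG 0 L (by rwa [zero_add])
    rwa [h0, zero_add, Nat.sub_zero, Nat.Ico_zero_eq_range] at this
  have h2 : ∀ v, batchWait K (((Finset.range n).filter fun j => v ≤ oo j).card - K) ≤
      ∑ k ∈ Finset.range L, (if v ≤ oo (G k) then 1 else 0) * (n - G (k + 1)) := by
    intro v
    have hc := Finset.card_filter_add_card_filter_not (s := Finset.range n) (fun j => v ≤ oo j)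
    rw [Finset.card_range] at hc
    set x := ((Finset.range n).filter fun j => ¬ v ≤ oo j).card with hx
    rw [show ((Finset.range n).filter fun j => v ≤ oo j).card = n - x by omega]
    refine (batchWait_le_sum_ite hK G hG hmono h0 L hL x (by omega)).trans
      (Finset.sum_le_sum fun k _ => ?_)
    split_ifs with h3 h4 h4
    · simp
    · -- Every position up to `G k` would hold a request shorter than `v`.
      have hle : min (G k + 1) n ≤ x := by
        rw [hx, ← Finset.card_range (min (G k + 1) n)]
        refine Finset.card_le_card fun j hj => ?_
        rw [Finset.mem_range] at hj
        rw [Finset.mem_filter, Finset.mem_range]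
        have := h.mono (show j ≤ G k by omega)
        omega
      have := hmono (Nat.le_succ k)
      simp only [Nat.succ_eq_add_one] at this
      omega
    · simp
    · simp
  calc _ ≤ ℓ * ∑ k ∈ Finset.range L, (n - G (k + 1)) + ∑ v ∈ Finset.Ioc ℓ u,
        ∑ k ∈ Finset.range L, (if v ≤ oo (G k) then 1 else 0) * (n - G (k + 1)) :=
        Nat.add_le_add (Nat.mul_le_mul_left _ h1) (Finset.sum_le_sum fun v _ => h2 v)
    _ = ∑ k ∈ Finset.range L, oo (G k) * (n - G (k + 1)) := by
        rw [Finset.sum_comm, Finset.mul_sum, ← Finset.sum_add_distrib]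
        refine Finset.sum_congr rfl fun k _ => ?_
        rw [← Finset.sum_mul, ← add_mul, ← eq_add_sum_ite (h.le_length _) (h.length_le _)]

end ShortestFirst

/-! ### Comparison of the latencies -/

section Ratio

theorem exists_first_waiting {n : ℕ} (st : Fin n → ℕ) (t : ℕ) (j : Fin n) (hj : t < st j) :
    ∃ j₁, t < st j₁ ∧ ∀ i < j₁, st i ≤ t := by
  obtain ⟨j₁, h1, h2⟩ := WellFounded.has_min (wellFounded_lt (α := Fin n)) {j | t < st j} ⟨j, hj⟩
  exact ⟨j₁, h1, fun i hi => not_lt.1 fun h => h2 i h hi⟩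

theorem totalLatency_eq {n : ℕ} (M s : ℕ) (o len : Fin n → ℕ) (σ : Equiv.Perm (Fin n))
    (st : Fin n → ℕ) (h : ∀ j, startTime M s o len (List.ofFn σ) (σ j) = st j) :
    totalLatency M s o len (List.ofFn σ) = ((∑ j, st j + ∑ i, o i : ℕ) : ℝ≥0∞) := by
  unfold totalLatency
  rw [Finset.sum_add_distrib, ← Equiv.sum_comp σ]
  simp [h]

/-- Since every projected length is at most `u`, a waiting request could be added if fewer than
`⌊M / (s + u)⌋` requests were in process. -/
theorem totalLatency_amax_le {n M s u : ℕ} (hu : 0 < u) (hM : s + u ≤ M) (o : Fin n → ℕ)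
    (ho : ∀ i, 1 ≤ o i ∧ o i ≤ u) (σ : Equiv.Perm (Fin n)) :
    totalLatency M s o (fun _ => u) (List.ofFn σ) ≤
      ((∑ j : Fin n, (n - 1 - j) / (M / (s + u)) * o (σ j) + ∑ i, o i : ℕ) : ℝ≥0∞) := by
  obtain ⟨st, hmono, hst, -, hmax⟩ := exists_schedule M s o (fun _ => u) σ hM ho fun _ => le_rfl
  rw [totalLatency_eq M s o _ σ st hst]
  refine Nat.cast_le.2 (Nat.add_le_add_right ?_ _)
  set p : ℕ → ℕ := fun j => if h : j < n then st ⟨j, h⟩ else 0 with hp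
  set oo : ℕ → ℕ := fun j => if h : j < n then o (σ ⟨j, h⟩) else 0 with hoo
  have hpf : ∀ j : Fin n, p j = st j := fun j => by simp [hp]
  have hof : ∀ j : Fin n, oo j = o (σ j) := fun j => by simp [hoo]
  have key := sum_start_le (n := n) (Nat.div_pos hM (by omega)) p oo ?_
  · rw [← Fin.sum_univ_eq_sum_range, ← Fin.sum_univ_eq_sum_range (fun j =>
      (n - 1 - j) / (M / (s + u)) * oo j)] at key
    simpa only [hpf, hof] using key
  · intro j hj t ht
    have ht' : t < st ⟨j, hj⟩ := by rwa [← hpf ⟨j, hj⟩]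
    obtain ⟨j₁, h1, h2⟩ := exists_first_waiting st t ⟨j, hj⟩ ht'
    obtain ⟨x, -, hx⟩ := hmax t j₁ h1 h2
    have hsum : ∑ i, (if st i ≤ t ∧ t < st i + o (σ i) then memory s u (st i) x else 0) ≤
        (Finset.univ.filter fun i => st i ≤ t ∧ t < st i + o (σ i)).card * (s + u) := by
      rw [Finset.card_filter, Finset.sum_mul]
      refine Finset.sum_le_sum fun i _ => ?_
      have := memory_le s u (st i) x
      split_ifs <;> omega
    have hlt : M < ((Finset.univ.filter fun i => st i ≤ t ∧ t < st i + o (σ i)).card + 1) *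
        (s + u) := by
      have := memory_le s u t x
      rw [add_mul, one_mul]
      omega
    have hN := (Nat.div_lt_iff_lt_mul (by omega)).2 hlt
    refine (Nat.lt_succ_iff.1 hN).trans ?_
    refine Finset.card_le_card_of_injOn (fun i : Fin n => (i : ℕ)) ?_
      (fun a _ b _ hab => Fin.ext hab)
    intro i hi
    simp only [Finset.coe_filter, Finset.mem_univ, true_and, Set.mem_ofPred_eq,
      Finset.mem_range] at hi ⊢
    rw [hpf, hof]
    refine ⟨?_, hi⟩
    by_contra! hji
    have := hmono (show (⟨j, hj⟩ : Fin n) ≤ i from hji)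
    omega

theorem card_mul_sum_perm {n : ℕ} (f : Fin n → ℕ) (j : Fin n) :
    n * ∑ σ : Equiv.Perm (Fin n), f (σ j) = n.factorial * ∑ i, f i := by
  have h : ∀ i, ∑ σ : Equiv.Perm (Fin n), f (σ i) = ∑ σ : Equiv.Perm (Fin n), f (σ j) := by
    intro i
    rw [← Equiv.sum_comp (Equiv.mulRight (Equiv.swap i j))]
    simp
  calc n * ∑ σ : Equiv.Perm (Fin n), f (σ j)
      = ∑ i : Fin n, ∑ σ : Equiv.Perm (Fin n), f (σ i) := by simp [h]
    _ = ∑ σ : Equiv.Perm (Fin n), ∑ i, f (σ i) := Finset.sum_comm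
    _ = n.factorial * ∑ i, f i := by simp [Equiv.sum_comp, Fintype.card_perm]

theorem card_mul_amaxExpectedLatency_le {n M s u : ℕ} (hu : 0 < u) (hM : s + u ≤ M)
    (o : Fin n → ℕ) (ho : ∀ i, 1 ≤ o i ∧ o i ≤ u) :
    n * amaxExpectedLatency M s u o ≤
      (((∑ i, o i) * (n + batchWait (M / (s + u)) n) : ℕ) : ℝ≥0∞) := by
  set w : Fin n → ℕ := fun j => (n - 1 - j) / (M / (s + u)) with hw
  have h1 : ∑ σ : Equiv.Perm (Fin n), totalLatency M s o (fun _ => u) (List.ofFn σ) ≤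
      ((∑ σ : Equiv.Perm (Fin n), (∑ j : Fin n, w j * o (σ j) + ∑ i, o i) : ℕ) : ℝ≥0∞) := by
    rw [Nat.cast_sum]
    exact Finset.sum_le_sum fun σ _ => totalLatency_amax_le hu hM o ho σ
  have hwsum : ∑ j, w j = batchWait (M / (s + u)) n := by
    rw [batchWait, ← Finset.sum_range_reflect, ← Fin.sum_univ_eq_sum_range (fun j =>
      (n - 1 - j) / (M / (s + u)))]
  have h2 : n * ∑ σ : Equiv.Perm (Fin n), (∑ j : Fin n, w j * o (σ j) + ∑ i, o i) =
      n.factorial * ((∑ i, o i) * (n + batchWait (M / (s + u)) n)) := by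
    rw [Finset.sum_add_distrib, Finset.sum_comm]
    simp only [← Finset.mul_sum, Finset.sum_const, Finset.card_univ, Fintype.card_perm,
      Fintype.card_fin, smul_eq_mul]
    rw [mul_add, Finset.mul_sum, ← hwsum]
    have : ∀ j, n * (w j * ∑ σ : Equiv.Perm (Fin n), o (σ j)) =
        w j * (n.factorial * ∑ i, o i) := fun j => by
      rw [mul_left_comm, card_mul_sum_perm]
    simp only [this]
    rw [← Finset.sum_mul]
    ring
  have hf0 : (n.factorial : ℝ≥0∞) ≠ 0 := by exact_mod_cast n.factorial_ne_zero
  unfold amaxExpectedLatency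
  rw [← mul_div_assoc, ENNReal.div_le_iff hf0 (ENNReal.natCast_ne_top _)]
  refine (mul_le_mul_right h1 _).trans (le_of_eq ?_)
  rw [← Nat.cast_mul, h2, mul_comm, Nat.cast_mul]

theorem exists_isShortestFirst {n M s ℓ u : ℕ} (hℓ : 0 < ℓ) (hℓu : ℓ ≤ u) (hM : s + u ≤ M)
    (o : Fin n → ℕ) (ho : ∀ i, ℓ ≤ o i ∧ o i ≤ u) :
    ∃ oo st : ℕ → ℕ, IsShortestFirst n M s ℓ u oo st ∧
      ∑ j ∈ Finset.range n, oo j = ∑ i, o i ∧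
      hsfLatency M s o = ((∑ j ∈ Finset.range n, st j + ∑ i, o i : ℕ) : ℝ≥0∞) := by
  set σ := Tuple.sort o with hσ
  obtain ⟨st, hmono, hst, hfeas, hmax⟩ := exists_schedule M s o o σ hM
    (fun i => ⟨hℓ.trans_le (ho i).1, (ho i).2⟩) fun i => (ho i).2
  set p : ℕ → ℕ := fun j => if h : j < n then st ⟨j, h⟩ else 0 with hp
  set oo : ℕ → ℕ := fun j => if h : j < n then o (σ ⟨j, h⟩) else u with hoo
  have hpf : ∀ j : Fin n, p j = st j := fun j => by simp [hp]
  have hof : ∀ j : Fin n, oo j = o (σ j) := fun j => by simp [hoo]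
  refine ⟨oo, p, ⟨hℓ, ?_, ?_, ?_, ?_, ?_, ?_⟩, ?_, ?_⟩
  · intro i j hij
    by_cases hj : j < n
    · have hi : i < n := by omega
      simp only [hoo, hi, hj, dif_pos]
      exact Tuple.monotone_sort o (show (⟨i, hi⟩ : Fin n) ≤ ⟨j, hj⟩ from hij)
    · simp only [hoo, hj, dif_neg, not_false_eq_true]
      split_ifs
      · exact (ho _).2
      · exact le_rfl
  · intro j
    simp only [hoo]
    split_ifs
    · exact (ho _).1
    · exact hℓu
  · intro j
    simp only [hoo]
    split_ifs
    · exact (ho _).2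
    · exact le_rfl
  · intro i j hij hj
    have hi : i < n := by omega
    simp only [hp, hi, hj, dif_pos]
    exact hmono (show (⟨i, hi⟩ : Fin n) ≤ ⟨j, hj⟩ from hij)
  · intro x
    rw [← Fin.sum_univ_eq_sum_range (fun j => memory s (oo j) (p j) x)]
    simp only [hpf, hof]
    cases x with
    | zero => simp [memory]
    | succ t =>
      refine le_trans (Finset.sum_le_sum fun j _ => ?_) (hfeas t (t + 1) (Nat.lt_succ_self t))
      unfold memory
      split_ifs <;> omega
  · intro t j hj htj hi
    have hj' : t < st ⟨j, hj⟩ := by rwa [← hpf ⟨j, hj⟩]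
    obtain ⟨x, hx, h⟩ := hmax t ⟨j, hj⟩ hj' fun i hij => by
      rw [← hpf]
      exact hi i hij
    refine ⟨x, hx, h.trans_le ?_⟩
    rw [← hof ⟨j, hj⟩, ← Fin.sum_univ_eq_sum_range (fun i =>
      if p i ≤ t then memory s (oo i) (p i) x else 0)]
    refine Nat.add_le_add_right (Finset.sum_le_sum fun i _ => ?_) _
    rw [hpf, hof]
    split_ifs <;> omega
  · rw [← Fin.sum_univ_eq_sum_range]
    simp only [hof]
    exact Equiv.sum_comp σ o
  · rw [hsfLatency, totalLatency_eq M s o o _ st hst, ← Fin.sum_univ_eq_sum_range]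
    simp only [hpf]

/-- The comparison of the two latency bounds, cleared of denominators. Level by level it is
`two_mul_mul_batchWait_le`; the change of the batch size costs the factor `K / N`. -/
theorem length_mul_batchWait_le {n ℓ u N K H : ℕ} (hℓu : ℓ ≤ u) (hN : 0 < N) (hNK : N ≤ K)
    (oo : ℕ → ℕ) (hoo : ∀ j, ℓ ≤ oo j ∧ oo j ≤ u)
    (hH : ℓ * batchWait K n + ∑ v ∈ Finset.Ioc ℓ u,
      batchWait K (((Finset.range n).filter fun j => v ≤ oo j).card - K) +
        ∑ j ∈ Finset.range n, oo j ≤ H) :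
    2 * ℓ * N * ((∑ j ∈ Finset.range n, oo j) * (n + batchWait N n)) ≤
      K * (n * (ℓ + u) * H) := by
  have hK := hN.trans_le hNK
  set y : ℕ → ℕ := fun v => ((Finset.range n).filter fun j => v ≤ oo j).card with hy
  have hO : ∑ j ∈ Finset.range n, oo j = n * ℓ + ∑ v ∈ Finset.Ioc ℓ u, y v := by
    rw [Finset.sum_congr rfl fun j _ => eq_add_sum_ite (hoo j).1 (hoo j).2,
      Finset.sum_add_distrib, Finset.sum_const, Finset.card_range, smul_eq_mul, Finset.sum_comm]
    simp only [hy, Finset.card_filter]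
  have hlev : 2 * (∑ v ∈ Finset.Ioc ℓ u, y v) * (n + batchWait K n) ≤
      (u - ℓ) * (n * (n + batchWait K n)) +
        2 * n * ∑ v ∈ Finset.Ioc ℓ u, (y v + batchWait K (y v - K)) := by
    rw [Finset.mul_sum, Finset.sum_mul, Finset.mul_sum, ← Nat.card_Ioc,
      ← smul_eq_mul (Finset.card _), ← Finset.sum_const, ← Finset.sum_add_distrib]
    refine Finset.sum_le_sum fun v _ => two_mul_mul_batchWait_le hK ?_
    exact (Finset.card_filter_le _ _).trans (Finset.card_range n).le
  have hbatch := mul_batchWait_mono hN hNK n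
  rw [hO, add_comm (n * ℓ)] at hH
  rw [hO]
  rw [Finset.sum_add_distrib] at hlev
  obtain ⟨w, rfl⟩ : ∃ w, u = ℓ + w := ⟨u - ℓ, by omega⟩
  rw [Nat.add_sub_cancel_left] at hlev
  generalize n + batchWait N n = BN at *
  set B := n + batchWait K n with hB
  generalize ∑ v ∈ Finset.Ioc ℓ (ℓ + w), y v = Y at *
  generalize ∑ v ∈ Finset.Ioc ℓ (ℓ + w), batchWait K (y v - K) = E at *
  have hH' : ℓ * B + (Y + E) ≤ H := by
    rw [hB, mul_add]
    linarith
  have h1 : 2 * ((n * ℓ + Y) * B) ≤ n * ((ℓ + (ℓ + w)) * B + 2 * (Y + E)) := by linarith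
  have h2 : ℓ * ((ℓ + (ℓ + w)) * B + 2 * (Y + E)) ≤ (ℓ + (ℓ + w)) * H := by
    have h3 := Nat.mul_le_mul_left (ℓ + (ℓ + w)) hH'
    have h4 : 0 ≤ w * (Y + E) := Nat.zero_le _
    linarith
  calc 2 * ℓ * N * ((n * ℓ + Y) * BN) = 2 * ℓ * (n * ℓ + Y) * (N * BN) := by ring
    _ ≤ 2 * ℓ * (n * ℓ + Y) * (K * B) := Nat.mul_le_mul_left _ hbatch
    _ = K * (ℓ * (2 * ((n * ℓ + Y) * B))) := by ring
    _ ≤ K * (ℓ * (n * ((ℓ + (ℓ + w)) * B + 2 * (Y + E)))) := by gcongr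
    _ = K * (n * (ℓ * ((ℓ + (ℓ + w)) * B + 2 * (Y + E)))) := by ring
    _ ≤ K * (n * ((ℓ + (ℓ + w)) * H)) := by gcongr
    _ = K * (n * (ℓ + (ℓ + w)) * H) := by ring

/-- The ratio of the two batch sizes is at most `u / ℓ`, up to `O(1 / M)`. -/
theorem batch_size_le {M s ℓ u : ℕ} (hℓ : 0 < ℓ) (hℓu : ℓ ≤ u) (hM : 2 * (s + u) ≤ M) :
    ((M / (s + ℓ) + s + u : ℕ) : ℝ) ≤
      (u / ℓ + 2 * (s + u) * (s + u + u / ℓ) / M) * (M / (s + u) : ℕ) := by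
  have hℓ0 : (0 : ℝ) < ℓ := by exact_mod_cast hℓ
  have hlu : (ℓ : ℝ) ≤ u := by exact_mod_cast hℓu
  have hs0 : (0 : ℝ) ≤ s := Nat.cast_nonneg s
  have hM' : 2 * ((s : ℝ) + u) ≤ M := by exact_mod_cast hM
  have hN : (M : ℝ) ≤ ((M / (s + u) : ℕ) + 1) * (s + u) := by
    have := Nat.lt_div_mul_add (a := M) (show 0 < s + u by omega)
    have h2 : M ≤ (M / (s + u) + 1) * (s + u) := by rw [add_mul, one_mul]; omega
    exact_mod_cast h2
  have hK : ((M / (s + ℓ) : ℕ) : ℝ) ≤ M / (s + ℓ) := by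
    have := @Nat.cast_div_le ℝ _ _ _ M (s + ℓ)
    simpa using this
  generalize ((M / (s + u) : ℕ) : ℝ) = N at *
  push_cast
  generalize ((M / (s + ℓ) : ℕ) : ℝ) = K at *
  generalize (M : ℝ) = M at *
  generalize (s : ℝ) = s at *
  generalize (ℓ : ℝ) = ℓ at *
  generalize (u : ℝ) = u at *
  set r := u / ℓ with hr
  have hc : 0 < s + u := by linarith
  have hM0 : 0 < M := by linarith
  have hr0 : 0 < r := div_pos (by linarith) hℓ0
  have h1 : M / (s + ℓ) ≤ r * (M / (s + u)) := by
    rw [hr, div_mul_div_comm, div_le_div_iff₀ (by linarith) (by positivity)]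
    nlinarith [mul_nonneg hM0.le (mul_nonneg hs0 (sub_nonneg.2 hlu))]
  have h2 : M / (s + u) ≤ N + 1 := by rwa [div_le_iff₀ hc]
  have h3 : s + u + r ≤ 2 * (s + u) * (s + u + r) / M * N := by
    rw [div_mul_eq_mul_div, le_div_iff₀ hM0]
    have : M ≤ 2 * (s + u) * N := by linarith
    nlinarith [mul_le_mul_of_nonneg_left this (show 0 ≤ s + u + r by linarith)]
  have h4 : r * (M / (s + u)) ≤ r * (N + 1) := mul_le_mul_of_nonneg_left h2 hr0.le
  linarith

end Ratio

end LLMScheduling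

theorem mainTheorem2 (s ℓ u : ℕ) (hs : 0 < s) (hℓ : 0 < ℓ) (hℓu : ℓ ≤ u)
    (α : ℝ) (hα : α = (ℓ : ℝ) / (u : ℝ)) :
    ∃ C : ℝ, ∀ᶠ M : ℕ in atTop,
      LLMScheduling.competitiveRatio M s ℓ u (LLMScheduling.amaxExpectedLatency M s u) ≤
        ENNReal.ofReal (α⁻¹ * (1 + α⁻¹) / 2 + C / (M : ℝ)) := by
  have hα' : α⁻¹ = (u : ℝ) / ℓ := by rw [hα, inv_div]
  rw [hα']
  refine ⟨2 * (s + u) * (s + u + u / ℓ) * ((1 + u / ℓ) / 2), ?_⟩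
  filter_upwards [eventually_ge_atTop
    (2 * (s + u) + (u * (s + u) * (s + u) + u * (s + u) + 1) * (s + u))] with M hM
  refine iSup₂_le fun n hn => iSup₂_le fun o ho => ?_
  have hu : 0 < u := by omega
  have hMu : s + u ≤ M := by omega
  obtain ⟨oo, st, hsf, hsum, hH⟩ :=
    LLMScheduling.exists_isShortestFirst (s := s) hℓ hℓu hMu o ho
  have hlow := hsf.le_sum_start (by omega)
  have hA := LLMScheduling.card_mul_amaxExpectedLatency_le hu hMu o
    fun i => ⟨hℓ.trans_le (ho i).1, (ho i).2⟩
  have hN : 0 < M / (s + u) := Nat.div_pos hMu (by omega)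
  have hNK : M / (s + u) ≤ M / (s + ℓ) + s + u := by
    have := Nat.div_le_div_left (a := M) (show s + ℓ ≤ s + u by omega) (by omega)
    omega
  have hcmp := LLMScheduling.length_mul_batchWait_le hℓu hN hNK oo
    (fun j => ⟨hsf.le_length j, hsf.length_le j⟩) (Nat.add_le_add_right hlow _)
  have hK := LLMScheduling.batch_size_le (s := s) hℓ hℓu (show 2 * (s + u) ≤ M by omega)
  rw [hsum] at hcmp
  rw [hH]
  generalize ∑ j ∈ Finset.range n, st j + ∑ i, o i = H at *
  generalize (∑ i, o i) * (n + LLMScheduling.batchWait (M / (s + u)) n) = Y at *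
  generalize M / (s + ℓ) + s + u = K at *
  generalize M / (s + u) = N at *
  have hn0 : (0 : ℝ) < n := by exact_mod_cast hn
  have hN0 : (0 : ℝ) < N := by exact_mod_cast hN
  have hℓ0 : (0 : ℝ) < ℓ := by exact_mod_cast hℓ
  have hcmp' : (2 * ℓ * N * Y : ℝ) ≤ K * (n * (ℓ + u) * H) := by exact_mod_cast hcmp
  refine ENNReal.div_le_of_le_mul ?_
  have hY : LLMScheduling.amaxExpectedLatency M s u o ≤ ENNReal.ofReal (Y / n) := by
    rw [ENNReal.ofReal_div_of_pos hn0, ENNReal.ofReal_natCast, ENNReal.ofReal_natCast,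
      ENNReal.le_div_iff_mul_le (Or.inl (by exact_mod_cast hn0.ne'))
        (Or.inl (ENNReal.natCast_ne_top n)), mul_comm]
    exact hA
  refine hY.trans ?_
  rw [← ENNReal.ofReal_natCast H, ← ENNReal.ofReal_mul (by positivity)]
  refine ENNReal.ofReal_le_ofReal ?_
  rw [div_le_iff₀ hn0]
  have h1 : (Y : ℝ) ≤ K / N * ((1 + u / ℓ) / 2) * H * n := by
    have : K / N * ((1 + u / ℓ) / 2) * H * n = K * (n * (ℓ + u) * H) / (2 * ℓ * N : ℝ) := by
      field_simp
    rw [this, le_div_iff₀ (by positivity)]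
    linarith
  refine h1.trans (mul_le_mul_of_nonneg_right (mul_le_mul_of_nonneg_right ?_ (by positivity))
    hn0.le)
  have h2 := (div_le_iff₀ hN0).2 hK
  refine (mul_le_mul_of_nonneg_right h2 (by positivity)).trans (le_of_eq ?_)
  ring
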